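/- Let $\mathscr A$ be a (not necessarily unital) $C^*$-algebra and $\mathscr X$ a Hilbert $\mathscr A$-module. Operators on $\mathscr X$ are $\mathscr A$-linear maps $t:\mathrm{Dom}(t)\to\mathscr X$ defined on a submodule $\mathrm{Dom}(t)\subseteq\mathscr X$; products $ts$ have domain $\{x\in\mathrm{Dom}(s): s(x)\in\mathrm{Dom}(t)\}$, and equality of operators includes equality of domains. An operator $t$ is *regular* if it is densely defined, closed, has a densely defined adjoint $t^*$, and $1+t^*t$ has dense range. A *Moore–Penrose inverse* of a regular operator $t$ is a regular operator $s$ with $tst=t$, $sts=s$, $(ts)^*=\overline{ts}$ and $(st)^*=\overline{st}$, where the bar denotes the closure of an operator. **Proposition.** Let $t$ be a regular operator on $\mathscr X$ such that $\overline{\mathrm{Ran}(t^*)}$ and $\overline{\mathrm{Ran}(t)}$ are orthogonally complemented in $\mathscr X$, i.e. $\mathscr X=\overline{\mathrm{Ran}(t^*)}\oplus\overline{\mathrm{Ran}(t^*)}^{\perp}$ and $\mathscr X=\overline{\mathrm{Ran}(t)}\oplus\overline{\mathrm{Ran}(t)}^{\perp}$. Then $t$ has a unique Moore–Penrose inverse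 $t^\dagger$, and $t$ is self-adjoint ($t=t^*$) if and only if $t=\overline{t^\dagger t}\,t^*$. -/

import Mathlib

noncomputable section

namespace HilbertModuleOp

variable (A : Type*) {X Y Z : Type*} [NonUnitalCStarAlgebra A] [PartialOrder A]
  [StarOrderedRing A]
  [NormedAddCommGroup X] [NormedSpace ℂ X] [SMul A X] [CStarModule A X]
  [NormedAddCommGroup Y] [NormedSpace ℂ Y] [SMul A Y] [CStarModule A Y]
  [NormedAddCommGroup Z] [NormedSpace ℂ Z]

/-- A partially defined operator is `A`-linear: its domain is an `A`-submodule, on which it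
commutes with the action of `A`. -/
def IsModuleLinear (t : X →ₗ.[ℂ] Y) : Prop :=
  ∀ (a : A) (x : t.domain), ∃ h : a • (x : X) ∈ t.domain, t ⟨a • (x : X), h⟩ = a • t x

/-- A partially defined operator whose domain is dense. -/
def IsDenselyDefined (t : X →ₗ.[ℂ] Y) : Prop := Dense (t.domain : Set X)

/-- The relation consisting of the pairs `(y, z)` with `⟪t x, y⟫ = ⟪x, z⟫` for all `x` in the
domain of `t`. -/
def adjointGraph (t : X →ₗ.[ℂ] Y) : Submodule ℂ (Y × X) where
  carrier := {p | ∀ x : t.domain, inner A (t x) p.1 = inner A (x : X) p.2}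
  add_mem' := by
    intro p q hp hq x
    simp only [Prod.fst_add, Prod.snd_add, CStarModule.inner_add_right, hp x, hq x]
  zero_mem' := by
    intro x
    simp
  smul_mem' := by
    intro c p hp x
    simp only [Prod.smul_fst, Prod.smul_snd, CStarModule.inner_smul_right_complex, hp x]

/-- The adjoint `t*`: its domain is the set of all `y` for which there is a `z` with
`⟪t x, y⟫ = ⟪x, z⟫` for all `x` in the domain of `t`, and `t* y = z`. It is meaningful for
densely defined `t`, where `z` is determined by `y`; only such `t` are used below. -/
def adjoint (t : X →ₗ.[ℂ] Y) : Y →ₗ.[ℂ] X := (adjointGraph A t).toLinearPMap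

variable {A} in
/-- For densely defined `t` the graph of the adjoint is the relation defining it. -/
theorem adjoint_graph_eq {t : X →ₗ.[ℂ] Y} (ht : IsDenselyDefined t) :
    (adjoint A t).graph = adjointGraph A t := by
  refine Submodule.toLinearPMap_graph_eq _ ?_
  rintro ⟨y, z⟩ hp hy
  dsimp at hy ⊢
  subst hy
  have h0 : ∀ x ∈ (t.domain : Set X), inner A x z = 0 := by
    intro x hx
    have := hp ⟨x, hx⟩
    simpa using this.symm
  have hc : Continuous (fun x : X => inner A x z) :=
    (CStarModule.continuous_inner (A := A) (E := X)).comp (continuous_id.prodMk continuous_const)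
  have h1 : (fun x : X => inner A x z) = fun _ => (0 : A) :=
    hc.ext_on ht continuous_const h0
  exact CStarModule.inner_self.1 (congrFun h1 z)

/-- The product `g f` of partially defined operators, with domain
`{x ∈ Dom f | f x ∈ Dom g}`. -/
def comp (g : Y →ₗ.[ℂ] Z) (f : X →ₗ.[ℂ] Y) : X →ₗ.[ℂ] Z where
  domain :=
    { carrier := {x | ∃ h : x ∈ f.domain, f ⟨x, h⟩ ∈ g.domain}
      add_mem' := by
        rintro x y ⟨hx, hx'⟩ ⟨hy, hy'⟩
        refine ⟨f.domain.add_mem hx hy, ?_⟩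
        have := f.map_add ⟨x, hx⟩ ⟨y, hy⟩
        exact this ▸ g.domain.add_mem hx' hy'
      zero_mem' := ⟨f.domain.zero_mem, by
        have := f.map_zero
        exact this ▸ g.domain.zero_mem⟩
      smul_mem' := by
        rintro c x ⟨hx, hx'⟩
        refine ⟨f.domain.smul_mem c hx, ?_⟩
        have := f.map_smul c ⟨x, hx⟩
        exact this ▸ g.domain.smul_mem c hx' }
  toFun :=
    { toFun := fun x => g ⟨f ⟨x, x.2.1⟩, x.2.2⟩
      map_add' := by
        intro x y
        rw [← g.map_add]
        congr 1
        exact Subtype.ext (f.map_add ⟨x, x.2.1⟩ ⟨y, y.2.1⟩)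
      map_smul' := by
        intro c x
        rw [RingHom.id_apply, ← g.map_smul]
        congr 1
        exact Subtype.ext (f.map_smul c ⟨x, x.2.1⟩) }

/-- The range of a partially defined operator. -/
def range (t : X →ₗ.[ℂ] Y) : Submodule ℂ Y := LinearMap.range t.toFun

/-- A regular operator: an `A`-linear, densely defined, closed and adjointable (that is, with
densely defined adjoint) operator `t` for which `1 + t* t` has dense range. -/
structure IsRegular (t : X →ₗ.[ℂ] Y) : Prop where
  moduleLinear : IsModuleLinear A t
  denselyDefined : IsDenselyDefined t
  isClosed : t.IsClosed
  adjointable : IsDenselyDefined (adjoint A t)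
  dense_range : Dense (Set.range
    fun x : (comp (adjoint A t) t).domain => (x : X) + comp (adjoint A t) t x)

/-- A (densely defined) operator is self-adjoint if it equals its adjoint. -/
def IsSelfAdjointOp (t : X →ₗ.[ℂ] X) : Prop := IsDenselyDefined t ∧ adjoint A t = t

/-- The orthogonal complement `W^⊥` with respect to the `A`-valued inner product. -/
def orthogonal (W : Submodule ℂ X) : Submodule ℂ X where
  carrier := {x | ∀ w ∈ W, inner A w x = 0}
  add_mem' := by
    intro x y hx hy w hw
    simp [hx w hw, hy w hw]
  zero_mem' := by
    intro w _
    simp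
  smul_mem' := by
    intro c x hx w hw
    simp [hx w hw]

/-- `W` is orthogonally complemented: the module is the direct sum of `W` and `W^⊥`. -/
def IsOrthogonallyComplemented (W : Submodule ℂ X) : Prop := IsCompl W (orthogonal A W)

/-- `s` is a Moore-Penrose inverse of `t`: it is regular, `t s t = t`, `s t s = s`,
`(t s)* = closure (t s)` and `(s t)* = closure (s t)`. The first two equations include the
domains, so that `t s` and `s t` have the domains of `s` and `t`, which are dense; the last two
then force `t s` and `s t` to be closable, since an adjoint is closed. -/
structure IsMoorePenroseInverse (t : X →ₗ.[ℂ] Y) (s : Y →ₗ.[ℂ] X) : Prop where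
  regular : IsRegular A s
  mul_mul_left : comp t (comp s t) = t
  mul_mul_right : comp s (comp t s) = s
  adjoint_left : adjoint A (comp t s) = (comp t s).closure
  adjoint_right : adjoint A (comp s t) = (comp s t).closure

end HilbertModuleOp

end

open Topology

namespace HilbertModuleOp

/-! ### Graphs, adjoints and orthogonality. -/

section Graph

variable {A X Y Z : Type*} [NonUnitalCStarAlgebra A] [PartialOrder A] [StarOrderedRing A]
  [NormedAddCommGroup X] [NormedSpace ℂ X] [SMul A X] [CStarModule A X]
  [NormedAddCommGroup Y] [NormedSpace ℂ Y] [SMul A Y] [CStarModule A Y]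
  [NormedAddCommGroup Z] [NormedSpace ℂ Z]

/-! Write `s` for the adjoint of `t`. Since ker t = Ran(s)^⊥ and ker s = Ran(t)^⊥, the hypotheses
split the module as closure(Ran s) ⊕ ker t and as closure(Ran t) ⊕ ker s. On closure(Ran s) the
operator t is injective and still has range Ran t; inverting it there and sending ker s to 0 defines
t†, with domain Ran t + ker s.

Then t†t and tt† are the two orthogonal projections restricted to the dense domains of t and t†, so
their closures and adjoints are both the full projections (`closure_eq_projectionOp`,
`adjoint_eq_projectionOp`). Regularity of t† uses t** = t and surjectivity of 1 + t*t and 1 + tt*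
(`IsRegular.isRegularPair`), which also give (t†)* = (t*)† (`adjoint_pinv`).

For uniqueness (`IsMoorePenroseInverse.eq_pinv`), symmetry of tr and rt forces r ⊆ t†, and
closedness of r gives the reverse inclusion.

The closure of t†t fixes Ran t*, so its product with t* is always t*; the criterion thus reads t =
t*. -/

theorem mem_comp_graph {g : Y →ₗ.[ℂ] Z} {f : X →ₗ.[ℂ] Y} {x : X} {z : Z} :
    (x, z) ∈ (comp g f).graph ↔ ∃ y, (x, y) ∈ f.graph ∧ (y, z) ∈ g.graph := by
  constructor
  · intro h
    obtain ⟨⟨u, hu, hu'⟩, rfl, rfl⟩ := (LinearPMap.mem_graph_iff _).1 h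
    exact ⟨f ⟨u, hu⟩, f.mem_graph ⟨u, hu⟩, g.mem_graph ⟨_, hu'⟩⟩
  · rintro ⟨y, hf, hg⟩
    obtain ⟨⟨u, hu⟩, rfl, rfl⟩ := (LinearPMap.mem_graph_iff _).1 hf
    obtain ⟨⟨v, hv⟩, h, rfl⟩ := (LinearPMap.mem_graph_iff _).1 hg
    change v = f ⟨u, hu⟩ at h
    subst h
    exact (comp g f).mem_graph ⟨u, hu, hv⟩

theorem mem_range_iff {t : X →ₗ.[ℂ] Y} {y : Y} : y ∈ range t ↔ ∃ x, (x, y) ∈ t.graph :=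
  t.mem_range_iff

theorem ext_graph {t s : X →ₗ.[ℂ] Y} (h : ∀ x y, (x, y) ∈ t.graph ↔ (x, y) ∈ s.graph) :
    t = s :=
  LinearPMap.eq_of_eq_graph (by ext ⟨x, y⟩; exact h x y)

theorem mem_adjointGraph {t : X →ₗ.[ℂ] Y} {y : Y} {z : X} :
    (y, z) ∈ adjointGraph A t ↔
      ∀ x x', (x, x') ∈ t.graph → inner A x' y = inner A x z := by
  constructor
  · intro h x x' hx
    obtain ⟨u, rfl, rfl⟩ := (LinearPMap.mem_graph_iff _).1 hx
    exact h u
  · intro h x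
    exact h _ _ (t.mem_graph x)

theorem mem_adjoint_graph {t : X →ₗ.[ℂ] Y} (ht : IsDenselyDefined t) {y : Y} {z : X} :
    (y, z) ∈ (adjoint A t).graph ↔
      ∀ x x', (x, x') ∈ t.graph → inner A x' y = inner A x z := by
  rw [adjoint_graph_eq ht, mem_adjointGraph]

theorem isModuleLinear_iff {t : X →ₗ.[ℂ] Y} :
    IsModuleLinear A t ↔ ∀ (a : A) x y, (x, y) ∈ t.graph → (a • x, a • y) ∈ t.graph := by
  constructor
  · intro h a x y hx
    obtain ⟨u, rfl, rfl⟩ := (LinearPMap.mem_graph_iff _).1 hx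
    obtain ⟨h1, h2⟩ := h a u
    have := t.mem_graph ⟨_, h1⟩
    rwa [h2] at this
  · intro h a x
    obtain ⟨u, h1, h2⟩ := (LinearPMap.mem_graph_iff _).1 (h a x (t x) (t.mem_graph x))
    dsimp at h1 h2
    refine ⟨h1 ▸ u.2, ?_⟩
    rw [← h2]
    congr 1
    exact Subtype.ext h1.symm

/-- An adjoint is always `A`-linear. -/
theorem isModuleLinear_adjoint {t : X →ₗ.[ℂ] Y} (ht : IsDenselyDefined t) :
    IsModuleLinear A (adjoint A t) := by
  rw [isModuleLinear_iff]
  intro a y z h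
  rw [mem_adjoint_graph ht] at h ⊢
  intro x x' hx
  simp only [CStarModule.inner_op_smul_right, h x x' hx]

/-- An adjoint is always closed. -/
theorem isClosed_adjoint {t : X →ₗ.[ℂ] Y} (ht : IsDenselyDefined t) :
    (adjoint A t).IsClosed := by
  rw [LinearPMap.IsClosed, adjoint_graph_eq ht]
  have : (adjointGraph A t : Set (Y × X)) =
      ⋂ x : t.domain, {p | inner A (t x) p.1 = inner A (x : X) p.2} := by
    ext p
    simp only [Set.mem_iInter]
    rfl
  rw [this]
  refine isClosed_iInter fun x => isClosed_eq ?_ ?_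
  · exact CStarModule.continuous_inner.comp (continuous_const.prodMk continuous_fst)
  · exact CStarModule.continuous_inner.comp (continuous_const.prodMk continuous_snd)

theorem inner_eq_zero_comm {x y : X} : inner A x y = 0 ↔ inner A y x = 0 := by
  rw [← CStarModule.star_inner, star_eq_zero]

theorem norm_le_of_inner_le {x : X} {y : Y} (h : inner A x x ≤ inner A y y) : ‖x‖ ≤ ‖y‖ := by
  rw [CStarModule.norm_eq_sqrt_norm_inner_self (A := A) x,
    CStarModule.norm_eq_sqrt_norm_inner_self (A := A) y]
  exact Real.sqrt_le_sqrt
    (CStarAlgebra.norm_le_norm_of_nonneg_of_le CStarModule.inner_self_nonneg h)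

/-- Without cross terms ⟪x + y, x + y⟫ exceeds ⟪x, x⟫ by a positive element. This is what makes
orthogonal projections continuous. -/
theorem norm_le_norm_add_of_inner_eq_zero {x y : X} (h : inner A x y = 0) : ‖x‖ ≤ ‖x + y‖ := by
  refine norm_le_of_inner_le (A := A) ?_
  simp only [CStarModule.inner_add_left, CStarModule.inner_add_right, h,
    inner_eq_zero_comm.1 h, add_zero, zero_add]
  exact le_add_of_nonneg_right CStarModule.inner_self_nonneg

theorem orthogonal_topologicalClosure (W : Submodule ℂ X) :
    orthogonal A W.topologicalClosure = orthogonal A W := by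
  apply le_antisymm
  · exact fun x hx w hw => hx w (W.le_topologicalClosure hw)
  · intro x hx w hw
    have hc : IsClosed {w : X | inner A w x = 0} := isClosed_eq
      (CStarModule.continuous_inner.comp (continuous_id.prodMk continuous_const)) continuous_const
    exact closure_minimal (show (W : Set X) ⊆ _ from hx) hc hw

end Graph

/-! ### Orthogonal projections and their densely defined restrictions. -/

section Projection

variable {A X : Type*} [NonUnitalCStarAlgebra A] [PartialOrder A] [StarOrderedRing A]
  [NormedAddCommGroup X] [NormedSpace ℂ X] [SMul A X] [CStarModule A X]

/-- The orthogonal projection onto a complemented submodule, as an operator with full domain. -/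
noncomputable def projectionOp {W : Submodule ℂ X} (hW : IsOrthogonallyComplemented A W) : X →ₗ.[ℂ] X :=
  (W.projection (orthogonal A W) hW).toPMap ⊤

theorem mem_projectionOp_graph {W : Submodule ℂ X} (hW : IsOrthogonallyComplemented A W)
    {x y : X} : (x, y) ∈ (projectionOp hW).graph ↔ y ∈ W ∧ x - y ∈ orthogonal A W := by
  have key : (x, y) ∈ (projectionOp hW).graph ↔ W.projection (orthogonal A W) hW x = y := by
    rw [LinearPMap.mem_graph_iff]
    constructor
    · rintro ⟨u, rfl, rfl⟩
      rfl
    · rintro rfl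
      exact ⟨⟨x, trivial⟩, rfl, rfl⟩
  rw [key]
  constructor
  · rintro rfl
    exact ⟨Submodule.projection_apply_mem hW x, Submodule.sub_projection_mem hW x⟩
  · rintro ⟨h1, h2⟩
    have h3 := (Submodule.projection_apply_eq_zero_iff hW).2 h2
    rwa [map_sub, Submodule.projection_apply_of_mem_left hW h1, sub_eq_zero] at h3

theorem projection_norm_le {W : Submodule ℂ X} (hW : IsOrthogonallyComplemented A W) (x : X) :
    ‖W.projection (orthogonal A W) hW x‖ ≤ ‖x‖ := by
  have := norm_le_norm_add_of_inner_eq_zero (A := A)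
    ((Submodule.sub_projection_mem hW x) _ (Submodule.projection_apply_mem hW x))
  rwa [add_sub_cancel] at this

theorem continuous_projection {W : Submodule ℂ X} (hW : IsOrthogonallyComplemented A W) :
    Continuous (W.projection (orthogonal A W) hW) :=
  ((W.projection (orthogonal A W) hW).mkContinuous 1
    (by simpa using projection_norm_le hW)).continuous

/-- The closure of a densely defined restriction of an orthogonal projection. -/
theorem closure_eq_projectionOp {W : Submodule ℂ X} (hW : IsOrthogonallyComplemented A W)
    {T : X →ₗ.[ℂ] X} (hd : IsDenselyDefined T) (hT : T ≤ projectionOp hW) :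
    T.closure = projectionOp hW := by
  set P := W.projection (orthogonal A W) hW
  have hcl : (projectionOp hW).IsClosed := by
    have : ((projectionOp hW).graph : Set (X × X)) = {p | P p.1 = p.2} := by
      ext ⟨x, y⟩
      simp only [SetLike.mem_coe, LinearPMap.mem_graph_iff, Set.mem_ofPred_eq]
      constructor
      · rintro ⟨u, rfl, rfl⟩
        rfl
      · rintro rfl
        exact ⟨⟨x, trivial⟩, rfl, rfl⟩
    rw [LinearPMap.IsClosed, this]
    exact isClosed_eq ((continuous_projection hW).comp continuous_fst) continuous_snd
  have hcb : T.IsClosable := hcl.isClosable.leIsClosable hT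
  apply LinearPMap.eq_of_eq_graph
  rw [← hcb.graph_closure_eq_closure_graph]
  apply le_antisymm
  · exact Submodule.topologicalClosure_minimal _ (LinearPMap.le_graph_of_le hT) hcl
  · intro p hp
    obtain ⟨u, hu⟩ := (LinearPMap.mem_graph_iff' _).1 hp
    -- The continuous map x ↦ (x, P x) sends the dense domain of `T` into the graph of `T`, hence
    -- every point into its closure.
    have hcont : Continuous fun x : X => (x, P x) :=
      continuous_id.prodMk (continuous_projection hW)
    have hmap : Set.MapsTo (fun x : X => (x, P x)) (T.domain : Set X) (T.graph : Set (X × X)) := by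
      intro x hx
      have h := T.mem_graph ⟨x, hx⟩
      rwa [hT.2 (x := ⟨x, hx⟩) (y := ⟨x, trivial⟩) rfl] at h
    have := map_mem_closure hcont (hd (u : X)) hmap
    rw [← hu]
    exact this

/-- The adjoint of a densely defined restriction of an orthogonal projection. -/
theorem adjoint_eq_projectionOp {W : Submodule ℂ X} (hW : IsOrthogonallyComplemented A W)
    {T : X →ₗ.[ℂ] X} (hd : IsDenselyDefined T) (hT : T ≤ projectionOp hW) :
    adjoint A T = projectionOp hW := by
  have hsymm : ∀ x x' y y', (x, x') ∈ (projectionOp hW).graph →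
      (y, y') ∈ (projectionOp hW).graph → inner A x' y = inner A x y' := by
    intro x x' y y' hx hy
    rw [mem_projectionOp_graph] at hx hy
    have h1 := hy.2 x' hx.1
    have h2 := inner_eq_zero_comm.1 (hx.2 y' hy.1)
    rw [CStarModule.inner_sub_right, sub_eq_zero] at h1
    rw [CStarModule.inner_sub_left, sub_eq_zero] at h2
    rw [h1, h2]
  apply ext_graph
  intro y z
  rw [mem_adjoint_graph hd]
  constructor
  · intro h
    have hy := (projectionOp hW).mem_graph ⟨y, trivial⟩
    set w := projectionOp hW ⟨y, trivial⟩
    suffices z = w by rwa [this]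
    -- Both `z` and the projection `w` of `y` represent the same functional on a dense domain, so `z
    -- - w` is orthogonal to everything.
    have h0 : ∀ x ∈ (T.domain : Set X), inner A x (z - w) = 0 := by
      intro x hx
      have h1 := h _ _ (T.mem_graph ⟨x, hx⟩)
      have h2 := hsymm _ _ _ _ (LinearPMap.le_graph_of_le hT (T.mem_graph ⟨x, hx⟩)) hy
      rw [CStarModule.inner_sub_right, ← h1, h2, sub_self]
    have hc : Continuous (fun x : X => inner A x (z - w)) :=
      CStarModule.continuous_inner.comp (continuous_id.prodMk continuous_const)
    have h1 := hc.ext_on hd continuous_const h0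
    exact sub_eq_zero.1 (CStarModule.inner_self.1 (congrFun h1 (z - w)))
  · intro h x x' hx
    exact hsymm _ _ _ _ (LinearPMap.le_graph_of_le hT hx) h

end Projection

/-! ### Regular operators and their adjoints. -/

section RegularPair

variable {A X Y : Type*} [NonUnitalCStarAlgebra A] [PartialOrder A] [StarOrderedRing A]
  [NormedAddCommGroup X] [NormedSpace ℂ X] [SMul A X] [CStarModule A X]
  [NormedAddCommGroup Y] [NormedSpace ℂ Y] [SMul A Y] [CStarModule A Y]

/-- The range of `1 + s t`. -/
def oneAddRange (t : X →ₗ.[ℂ] Y) (s : Y →ₗ.[ℂ] X) : Submodule ℂ X where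
  carrier := {v | ∃ x y, (x, y) ∈ t.graph ∧ (y, v - x) ∈ s.graph}
  add_mem' := by
    rintro v w ⟨x, y, h1, h2⟩ ⟨x', y', h1', h2'⟩
    refine ⟨x + x', y + y', t.graph.add_mem h1 h1', ?_⟩
    have := s.graph.add_mem h2 h2'
    rwa [Prod.mk_add_mk, sub_add_sub_comm] at this
  zero_mem' := ⟨0, 0, t.graph.zero_mem, by simp⟩
  smul_mem' := by
    rintro c v ⟨x, y, h1, h2⟩
    refine ⟨c • x, c • y, t.graph.smul_mem c h1, ?_⟩
    have := s.graph.smul_mem c h2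
    rwa [Prod.smul_mk, smul_sub] at this

theorem mem_oneAddRange {t : X →ₗ.[ℂ] Y} {s : Y →ₗ.[ℂ] X} {v : X} :
    v ∈ oneAddRange t s ↔ ∃ x y, (x, y) ∈ t.graph ∧ (y, v - x) ∈ s.graph := Iff.rfl

theorem coe_oneAddRange (t : X →ₗ.[ℂ] Y) (s : Y →ₗ.[ℂ] X) :
    (oneAddRange t s : Set X) = Set.range fun x : (comp s t).domain => (x : X) + comp s t x := by
  ext v
  simp only [SetLike.mem_coe, mem_oneAddRange, Set.mem_range]
  constructor
  · rintro ⟨x, y, h1, h2⟩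
    obtain ⟨u, hu, hu'⟩ := (LinearPMap.mem_graph_iff _).1 (mem_comp_graph.2 ⟨y, h1, h2⟩)
    exact ⟨u, by rw [hu, hu']; simp⟩
  · rintro ⟨u, rfl⟩
    obtain ⟨y, h1, h2⟩ := mem_comp_graph.1 ((comp s t).mem_graph u)
    exact ⟨u, y, h1, by simpa using h2⟩

/-- `t` and `s` are formally adjoint to each other. -/
def IsFormalAdjoint (A : Type*) {X Y : Type*} [NonUnitalCStarAlgebra A] [PartialOrder A]
    [NormedAddCommGroup X] [NormedSpace ℂ X] [SMul A X] [CStarModule A X]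
    [NormedAddCommGroup Y] [NormedSpace ℂ Y] [SMul A Y] [CStarModule A Y]
    (t : X →ₗ.[ℂ] Y) (s : Y →ₗ.[ℂ] X) : Prop :=
  ∀ x x' y y', (x, x') ∈ t.graph → (y, y') ∈ s.graph → inner A x' y = inner A x y'

theorem IsFormalAdjoint.symm {t : X →ₗ.[ℂ] Y} {s : Y →ₗ.[ℂ] X} (h : IsFormalAdjoint A t s) :
    IsFormalAdjoint A s t := by
  intro y y' x x' hy hx
  rw [← CStarModule.star_inner, ← h x x' y y' hx hy, CStarModule.star_inner]

theorem isFormalAdjoint_adjoint {t : X →ₗ.[ℂ] Y} (ht : IsDenselyDefined t) :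
    IsFormalAdjoint A t (adjoint A t) :=
  fun x x' _ _ hx hy => (mem_adjoint_graph ht).1 hy x x' hx

/-- For v = x + stx, the element ⟪v, v⟫ expands to ⟪x, x⟫ + 2⟪tx, tx⟫ + ⟪stx, stx⟫, all terms
positive. Hence 1 + st is bounded below. -/
theorem IsFormalAdjoint.inner_le {t : X →ₗ.[ℂ] Y} {s : Y →ₗ.[ℂ] X} (h : IsFormalAdjoint A t s)
    {x v : X} {y : Y} (h1 : (x, y) ∈ t.graph) (h2 : (y, v - x) ∈ s.graph) :
    inner A x x ≤ inner A v v ∧ inner A y y ≤ inner A v v := by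
  obtain ⟨w, rfl⟩ : ∃ w, v = x + w := ⟨v - x, by simp⟩
  rw [add_sub_cancel_left] at h2
  have e1 := h x y y w h1 h2
  have e2 := h.symm y w x y h2 h1
  have e : inner A (x + w) (x + w) =
      inner A x x + (inner A y y + inner A y y + inner A w w) := by
    simp only [CStarModule.inner_add_left, CStarModule.inner_add_right, ← e1, e2]
    abel
  have px : 0 ≤ inner A x x := CStarModule.inner_self_nonneg
  have py : 0 ≤ inner A y y := CStarModule.inner_self_nonneg
  have pw : 0 ≤ inner A w w := CStarModule.inner_self_nonneg
  rw [e]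
  refine ⟨le_add_of_nonneg_right (by positivity), ?_⟩
  rw [add_assoc, ← add_assoc, add_comm (inner A x x), add_assoc]
  exact le_add_of_nonneg_right (by positivity)

/-- The range of `1 + s t` is closed. -/
theorem IsFormalAdjoint.isClosed_oneAddRange [CompleteSpace X] [CompleteSpace Y]
    {t : X →ₗ.[ℂ] Y} {s : Y →ₗ.[ℂ] X} (h : IsFormalAdjoint A t s)
    (ht : t.IsClosed) (hs : s.IsClosed) : IsClosed (oneAddRange t s : Set X) := by
  -- The triples (x, tx, x + stx) form a closed, hence complete, space; projecting to the last entry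
  -- is bounded below, so its range is closed.
  let G : Submodule ℂ (X × Y × X) :=
    { carrier := {p | (p.1, p.2.1) ∈ t.graph ∧ (p.2.1, p.2.2 - p.1) ∈ s.graph}
      add_mem' := by
        rintro p q ⟨h1, h2⟩ ⟨h1', h2'⟩
        refine ⟨t.graph.add_mem h1 h1', ?_⟩
        have := s.graph.add_mem h2 h2'
        rwa [Prod.mk_add_mk, sub_add_sub_comm] at this
      zero_mem' := ⟨t.graph.zero_mem, by simp⟩
      smul_mem' := by
        rintro c p ⟨h1, h2⟩
        refine ⟨t.graph.smul_mem c h1, ?_⟩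
        have := s.graph.smul_mem c h2
        rwa [Prod.smul_mk, smul_sub] at this }
  have hG : IsClosed (G : Set (X × Y × X)) := by
    have c1 : Continuous fun p : X × Y × X => (p.1, p.2.1) := by fun_prop
    have c2 : Continuous fun p : X × Y × X => (p.2.1, p.2.2 - p.1) := by fun_prop
    exact (IsClosed.preimage c1 ht).inter (IsClosed.preimage c2 hs)
  have : CompleteSpace G := hG.completeSpace_coe
  let f : G →L[ℂ] X :=
    (ContinuousLinearMap.snd ℂ Y X).comp ((ContinuousLinearMap.snd ℂ X (Y × X)).comp G.subtypeL)
  have hf : AntilipschitzWith 1 f := by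
    refine AddMonoidHomClass.antilipschitz_of_bound f fun p => ?_
    obtain ⟨⟨x, y, v⟩, h1, h2⟩ := p
    have h3 := h.inner_le h1 h2
    change max ‖x‖ (max ‖y‖ ‖v‖) ≤ ((1 : NNReal) : ℝ) * ‖v‖
    rw [NNReal.coe_one, one_mul]
    exact max_le (norm_le_of_inner_le h3.1) (max_le (norm_le_of_inner_le h3.2) le_rfl)
  have hr : (oneAddRange t s : Set X) = Set.range f := by
    ext v
    constructor
    · rintro ⟨x, y, h1, h2⟩
      exact ⟨⟨(x, y, v), h1, h2⟩, rfl⟩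
    · rintro ⟨⟨⟨x, y, v⟩, h1, h2⟩, rfl⟩
      exact ⟨x, y, h1, h2⟩
  rw [hr]
  exact hf.isClosed_range f.uniformContinuous

/-- A regular operator together with its adjoint. -/
structure IsRegularPair (A : Type*) {X Y : Type*} [NonUnitalCStarAlgebra A] [PartialOrder A]
    [StarOrderedRing A]
    [NormedAddCommGroup X] [NormedSpace ℂ X] [SMul A X] [CStarModule A X]
    [NormedAddCommGroup Y] [NormedSpace ℂ Y] [SMul A Y] [CStarModule A Y]
    (t : X →ₗ.[ℂ] Y) (s : Y →ₗ.[ℂ] X) : Prop where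
  dense_left : IsDenselyDefined t
  dense_right : IsDenselyDefined s
  adjoint_left : adjoint A t = s
  adjoint_right : adjoint A s = t
  top_left : oneAddRange t s = ⊤
  top_right : oneAddRange s t = ⊤

namespace IsRegularPair

variable {t : X →ₗ.[ℂ] Y} {s : Y →ₗ.[ℂ] X}

/-- Every fact about `t` thereby also holds for its adjoint. -/
theorem symm (h : IsRegularPair A t s) : IsRegularPair A s t :=
  ⟨h.dense_right, h.dense_left, h.adjoint_right, h.adjoint_left, h.top_right, h.top_left⟩

theorem isFormalAdjoint (h : IsRegularPair A t s) : IsFormalAdjoint A t s :=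
  h.adjoint_left ▸ isFormalAdjoint_adjoint h.dense_left

theorem isClosed_left (h : IsRegularPair A t s) : t.IsClosed :=
  h.adjoint_right ▸ isClosed_adjoint h.dense_right

theorem isModuleLinear_left (h : IsRegularPair A t s) : IsModuleLinear A t :=
  h.adjoint_right ▸ isModuleLinear_adjoint h.dense_right

theorem isRegular (h : IsRegularPair A t s) : IsRegular A t where
  moduleLinear := h.isModuleLinear_left
  denselyDefined := h.dense_left
  isClosed := h.isClosed_left
  adjointable := h.adjoint_left ▸ h.dense_right
  dense_range := by
    rw [← coe_oneAddRange, h.adjoint_left, h.top_left]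
    exact dense_univ

/-- The kernel of `s` is the orthogonal complement of the range of `t`. -/
theorem mem_orthogonal_range (h : IsRegularPair A t s) {y : Y} :
    y ∈ orthogonal A (range t) ↔ (y, 0) ∈ s.graph := by
  rw [← h.adjoint_left, mem_adjoint_graph h.dense_left]
  simp only [CStarModule.inner_zero_right]
  constructor
  · exact fun hy x x' hx => hy x' (mem_range_iff.2 ⟨x, hx⟩)
  · intro hy w hw
    obtain ⟨x, hx⟩ := mem_range_iff.1 hw
    exact hy x w hx

theorem mem_orthogonal_closure_range (h : IsRegularPair A t s) {y : Y} :
    y ∈ orthogonal A (range t).topologicalClosure ↔ (y, 0) ∈ s.graph := by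
  rw [orthogonal_topologicalClosure, h.mem_orthogonal_range]

end IsRegularPair

/-- A regular operator and its adjoint form a regular pair. -/
theorem IsRegular.isRegularPair [CompleteSpace X] [CompleteSpace Y] {t : X →ₗ.[ℂ] Y}
    (h : IsRegular A t) : IsRegularPair A t (adjoint A t) := by
  set s := adjoint A t
  have hts : IsFormalAdjoint A t s := isFormalAdjoint_adjoint h.denselyDefined
  have hsc : s.IsClosed := isClosed_adjoint h.denselyDefined
  have htop : oneAddRange t s = ⊤ := by
    have hd := h.dense_range
    rw [← coe_oneAddRange] at hd
    rw [← SetLike.coe_set_eq, ← (hts.isClosed_oneAddRange h.isClosed hsc).closure_eq, hd.closure_eq]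
    rfl
  have htop' : oneAddRange s t = ⊤ := by
    have hd : Dense (oneAddRange s t : Set Y) := by
      -- The range of 1 + ts contains Dom s: if sv = x + stx and w = v - tx, then sw = x and w + tsw
      -- = v.
      refine h.adjointable.mono fun v hv => ?_
      have hv' := s.mem_graph ⟨v, hv⟩
      obtain ⟨x, y, h1, h2⟩ := mem_oneAddRange.1
        (htop ▸ Submodule.mem_top : s ⟨v, hv⟩ ∈ oneAddRange t s)
      refine ⟨v - y, x, ?_, by simpa using h1⟩
      have := s.graph.sub_mem hv' h2
      simpa using this
    rw [← SetLike.coe_set_eq, ← (hts.symm.isClosed_oneAddRange hsc h.isClosed).closure_eq,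
      hd.closure_eq]
    rfl
  refine ⟨h.denselyDefined, h.adjointable, rfl, ?_, htop, htop'⟩
  apply ext_graph
  intro x z
  rw [mem_adjoint_graph h.adjointable]
  constructor
  · intro hxz
    -- Solve x = p + stp and z = q' + tsq', and set q = tp, y = q' - q, y' = sy. Then (x + y', z -
    -- y) lies in the graph of t, and pairing with (y, y') gives ⟪y', y'⟫ = -⟪y, y⟫. Both vanish by
    -- positivity, leaving (x, z).
    obtain ⟨p, q, h1, h2⟩ := mem_oneAddRange.1 (htop ▸ Submodule.mem_top : x ∈ oneAddRange t s)
    obtain ⟨q', p', h3, h4⟩ := mem_oneAddRange.1 (htop' ▸ Submodule.mem_top : z ∈ oneAddRange s t)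
    have ht := t.graph.add_mem h1 h4
    have hy := s.graph.sub_mem h3 h2
    rw [Prod.mk_add_mk] at ht
    rw [Prod.mk_sub_mk] at hy
    set y := q' - q with hy_def
    set y' := p' - (x - p) with hy'_def
    have e1 : p + p' = x + y' := by rw [hy'_def]; abel
    have e2 : q + (z - q') = z - y := by rw [hy_def]; abel
    rw [e1, e2] at ht
    clear_value y y'
    have i1 := hxz y y' hy
    have i2 := hts.symm _ _ _ _ hy ht
    rw [CStarModule.inner_add_right, CStarModule.inner_sub_right, i1, sub_eq_add_neg,
      add_right_inj] at i2
    have i3 : inner A y y = 0 := by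
      apply le_antisymm _ CStarModule.inner_self_nonneg
      rw [← neg_nonneg, ← i2]
      exact CStarModule.inner_self_nonneg
    rw [i3, neg_zero] at i2
    rw [CStarModule.inner_self.1 i2, CStarModule.inner_self.1 i3] at ht
    simpa using ht
  · intro hx y y' hy
    exact hts.symm _ _ _ _ hy hx

end RegularPair

/-! ### The Moore-Penrose inverse: existence and uniqueness. -/

section PseudoInverse

variable {A X Y : Type*} [NonUnitalCStarAlgebra A] [PartialOrder A] [StarOrderedRing A]
  [NormedAddCommGroup X] [NormedSpace ℂ X] [SMul A X] [CStarModule A X]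
  [NormedAddCommGroup Y] [NormedSpace ℂ Y] [SMul A Y] [CStarModule A Y]

/-- The graph of the Moore-Penrose inverse of an operator `t` with adjoint `s`: the pairs
`(t x + z, x)` with `x` in the closure of the range of `s` and `z` in the kernel of `s`. -/
def pinvGraph (t : X →ₗ.[ℂ] Y) (s : Y →ₗ.[ℂ] X) : Submodule ℂ (Y × X) where
  carrier := {p | p.2 ∈ (range s).topologicalClosure ∧
    ∃ z, (z, 0) ∈ s.graph ∧ (p.2, p.1 - z) ∈ t.graph}
  add_mem' := by
    rintro p q ⟨h1, z, h2, h3⟩ ⟨h1', z', h2', h3'⟩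
    refine ⟨add_mem h1 h1', z + z', by simpa using s.graph.add_mem h2 h2', ?_⟩
    have := t.graph.add_mem h3 h3'
    rwa [Prod.mk_add_mk, sub_add_sub_comm] at this
  zero_mem' := ⟨zero_mem _, 0, s.graph.zero_mem, by simp⟩
  smul_mem' := by
    rintro c p ⟨h1, z, h2, h3⟩
    refine ⟨Submodule.smul_mem _ c h1, c • z, by simpa using s.graph.smul_mem c h2, ?_⟩
    have := t.graph.smul_mem c h3
    rwa [Prod.smul_mk, smul_sub] at this

/-- The Moore-Penrose inverse of an operator `t` with adjoint `s`. -/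
noncomputable def pinv (t : X →ₗ.[ℂ] Y) (s : Y →ₗ.[ℂ] X) : Y →ₗ.[ℂ] X := (pinvGraph t s).toLinearPMap

namespace IsRegularPair

variable {t : X →ₗ.[ℂ] Y} {s : Y →ₗ.[ℂ] X}

theorem inner_ker_eq_zero (h : IsRegularPair A t s) {x k : X}
    (hx : x ∈ (range s).topologicalClosure) (hk : (k, 0) ∈ t.graph) : inner A x k = 0 :=
  h.symm.mem_orthogonal_closure_range.2 hk x hx

theorem eq_zero_of_mem_ker (h : IsRegularPair A t s) {x : X}
    (hx : x ∈ (range s).topologicalClosure) (hk : (x, 0) ∈ t.graph) : x = 0 :=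
  CStarModule.inner_self.1 (h.inner_ker_eq_zero hx hk)

/-- Elements of the range of `t` and of the kernel of `s` are orthogonal. -/
theorem inner_ran_ker_eq_zero (h : IsRegularPair A t s) {x : X} {y z : Y}
    (hx : (x, y) ∈ t.graph) (hz : (z, 0) ∈ s.graph) : inner A y z = 0 :=
  h.mem_orthogonal_range.2 hz y (mem_range_iff.2 ⟨x, hx⟩)

/-- The relation is single-valued: if y = 0, then z lies in Ran t and in ker s, so z = 0, and x lies
in closure(Ran s) ∩ ker t = 0. -/
theorem mem_pinv_graph (h : IsRegularPair A t s) {y : Y} {x : X} :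
    (y, x) ∈ (pinv t s).graph ↔ x ∈ (range s).topologicalClosure ∧
      ∃ z, (z, 0) ∈ s.graph ∧ (x, y - z) ∈ t.graph := by
  rw [pinv, Submodule.toLinearPMap_graph_eq]
  · rfl
  · rintro ⟨y, x⟩ ⟨h1, z, h2, h3⟩ (rfl : y = 0)
    dsimp at h1 h3 ⊢
    have e := h.inner_ran_ker_eq_zero h3 h2
    rw [zero_sub, CStarModule.inner_neg_left, neg_eq_zero, CStarModule.inner_self] at e
    rw [e, sub_zero] at h3
    exact h.eq_zero_of_mem_ker h1 h3

/-- The decomposition with respect to the closed range of `s` and the kernel of `t`. -/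
theorem exists_add_ker (h : IsRegularPair A t s)
    (hs : IsOrthogonallyComplemented A (range s).topologicalClosure) (x : X) :
    ∃ p ∈ (range s).topologicalClosure, ∃ k, (k, 0) ∈ t.graph ∧ x = p + k := by
  obtain ⟨p, hp, k, hk, e⟩ := Submodule.mem_sup.1
    (hs.sup_eq_top ▸ Submodule.mem_top :
      x ∈ (range s).topologicalClosure ⊔ orthogonal A (range s).topologicalClosure)
  exact ⟨p, hp, k, h.symm.mem_orthogonal_closure_range.1 hk, e.symm⟩

theorem mem_closure_range (h : IsRegularPair A t s)
    (hs : IsOrthogonallyComplemented A (range s).topologicalClosure) {x : X}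
    (hx : ∀ k, (k, 0) ∈ t.graph → inner A k x = 0) : x ∈ (range s).topologicalClosure := by
  obtain ⟨p, hp, k, hk, rfl⟩ := h.exists_add_ker hs x
  have h1 := hx k hk
  rw [CStarModule.inner_add_right, inner_eq_zero_comm.1 (h.inner_ker_eq_zero hp hk), zero_add,
    CStarModule.inner_self] at h1
  rwa [h1, add_zero]

/-- On the range of `t`, the Moore-Penrose inverse picks preimages up to the kernel of `t`. -/
theorem mem_pinv_of_add (h : IsRegularPair A t s) {p k : X} {y : Y}
    (hp : p ∈ (range s).topologicalClosure) (hk : (k, 0) ∈ t.graph)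
    (hx : (p + k, y) ∈ t.graph) : (y, p) ∈ (pinv t s).graph := by
  rw [h.mem_pinv_graph]
  exact ⟨hp, 0, s.graph.zero_mem, by simpa using t.graph.sub_mem hx hk⟩

theorem isDenselyDefined_pinv (h : IsRegularPair A t s)
    (hs : IsOrthogonallyComplemented A (range s).topologicalClosure)
    (ht : IsOrthogonallyComplemented A (range t).topologicalClosure) :
    IsDenselyDefined (pinv t s) := by
  have hran : (range t).topologicalClosure ≤ (pinv t s).domain.topologicalClosure := by
    refine Submodule.topologicalClosure_mono fun y hy => ?_
    obtain ⟨x, hx⟩ := mem_range_iff.1 hy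
    obtain ⟨p, hp, k, hk, rfl⟩ := h.exists_add_ker hs x
    exact LinearPMap.mem_domain_of_mem_graph (h.mem_pinv_of_add hp hk hx)
  have hker : orthogonal A (range t).topologicalClosure ≤
      (pinv t s).domain.topologicalClosure := by
    intro z hz
    refine Submodule.le_topologicalClosure _ (LinearPMap.mem_domain_of_mem_graph (y := 0) ?_)
    rw [h.mem_pinv_graph]
    refine ⟨zero_mem _, z, h.mem_orthogonal_closure_range.1 hz, ?_⟩
    simp
  have htop : (pinv t s).domain.topologicalClosure = ⊤ :=
    top_le_iff.1 (ht.sup_eq_top ▸ sup_le hran hker)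
  exact Submodule.dense_iff_topologicalClosure_eq_top.2 htop

theorem adjoint_pinv (h : IsRegularPair A t s)
    (hs : IsOrthogonallyComplemented A (range s).topologicalClosure)
    (ht : IsOrthogonallyComplemented A (range t).topologicalClosure) :
    adjoint A (pinv t s) = pinv s t := by
  apply ext_graph
  intro u v
  rw [mem_adjoint_graph (h.isDenselyDefined_pinv hs ht), h.symm.mem_pinv_graph]
  constructor
  · intro huv
    have hv : v ∈ (range t).topologicalClosure := by
      refine h.symm.mem_closure_range ht fun z hz => ?_
      -- Since t† kills ker s, testing there shows that v is orthogonal to ker s.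
      have := huv z 0 (h.mem_pinv_graph.2 ⟨zero_mem _, z, hz, by simp⟩)
      rw [← this, CStarModule.inner_zero_left]
    obtain ⟨p, hp, k, hk, rfl⟩ := h.exists_add_ker hs u
    refine ⟨hv, k, hk, ?_⟩
    -- It remains to see that sv = p. Split x = q + l likewise: t† sends tx to q, and the cross
    -- terms ⟪q, k⟫ and ⟪l, p⟫ vanish.
    rw [add_sub_cancel_right, ← h.adjoint_left, mem_adjoint_graph h.dense_left]
    intro x x' hx
    obtain ⟨q, hq, l, hl, rfl⟩ := h.exists_add_ker hs x
    rw [← huv x' q (h.mem_pinv_of_add hq hl hx), CStarModule.inner_add_right,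
      CStarModule.inner_add_left, h.inner_ker_eq_zero hq hk,
      inner_eq_zero_comm.1 (h.inner_ker_eq_zero hp hl)]
  · rintro ⟨hv, k, hk, hvk⟩ y x hyx
    obtain ⟨hx, z, hz, hxz⟩ := h.mem_pinv_graph.1 hyx
    have e := h.isFormalAdjoint _ _ _ _ hxz hvk
    rw [CStarModule.inner_sub_left, CStarModule.inner_sub_right,
      inner_eq_zero_comm.1 (h.symm.inner_ker_eq_zero hv hz), h.inner_ker_eq_zero hx hk,
      sub_zero, sub_zero] at e
    exact e.symm

theorem oneAddRange_pinv (h : IsRegularPair A t s)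
    (ht : IsOrthogonallyComplemented A (range t).topologicalClosure) :
    oneAddRange (pinv t s) (pinv s t) = ⊤ := by
  rw [eq_top_iff]
  rintro y -
  obtain ⟨q, hq, z, hz, rfl⟩ := h.symm.exists_add_ker ht y
  -- Solve q = w + tsw and put x = sw. Then t† sends tx + z = q - w + z to x, and s† sends x to w,
  -- so 1 + s†t† sends q - w + z to q + z.
  obtain ⟨w, x, hwx, hxw⟩ := mem_oneAddRange.1
    (h.top_right ▸ Submodule.mem_top : q ∈ oneAddRange s t)
  have hw : w ∈ (range t).topologicalClosure := by
    have := sub_mem hq ((range t).le_topologicalClosure (mem_range_iff.2 ⟨x, hxw⟩))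
    rwa [sub_sub_cancel] at this
  refine ⟨q - w + z, x, ?_, ?_⟩
  · rw [h.mem_pinv_graph]
    refine ⟨(range s).le_topologicalClosure (mem_range_iff.2 ⟨w, hwx⟩), z, hz, ?_⟩
    rwa [add_sub_cancel_right]
  · have e : q + z - (q - w + z) = w := by abel
    rw [e, h.symm.mem_pinv_graph]
    exact ⟨hw, 0, t.graph.zero_mem, by simpa using hwx⟩

theorem pinv_isRegularPair (h : IsRegularPair A t s)
    (hs : IsOrthogonallyComplemented A (range s).topologicalClosure)
    (ht : IsOrthogonallyComplemented A (range t).topologicalClosure) :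
    IsRegularPair A (pinv t s) (pinv s t) :=
  ⟨h.isDenselyDefined_pinv hs ht, h.symm.isDenselyDefined_pinv ht hs, h.adjoint_pinv hs ht,
    h.symm.adjoint_pinv ht hs, h.oneAddRange_pinv ht, h.symm.oneAddRange_pinv hs⟩

theorem mem_comp_pinv_left (h : IsRegularPair A t s)
    (hs : IsOrthogonallyComplemented A (range s).topologicalClosure) {x p : X} :
    (x, p) ∈ (comp (pinv t s) t).graph ↔
      x ∈ t.domain ∧ (x, p) ∈ (projectionOp hs).graph := by
  rw [mem_comp_graph, mem_projectionOp_graph, h.symm.mem_orthogonal_closure_range]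
  constructor
  · rintro ⟨y, hy, hp⟩
    obtain ⟨hp, z, hz, hpz⟩ := h.mem_pinv_graph.1 hp
    have hk := t.graph.sub_mem hy hpz
    rw [Prod.mk_sub_mk, sub_sub_cancel] at hk
    -- Here `z` is both t(x - p) and an element of ker s, so it is orthogonal to itself.
    have : z = 0 := CStarModule.inner_self.1 (h.inner_ran_ker_eq_zero hk hz)
    exact ⟨LinearPMap.mem_domain_of_mem_graph hy, hp, this ▸ hk⟩
  · rintro ⟨hx, hp, hk⟩
    refine ⟨t ⟨x, hx⟩, t.mem_graph ⟨x, hx⟩, h.mem_pinv_of_add hp hk ?_⟩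
    rw [add_sub_cancel]
    exact t.mem_graph ⟨x, hx⟩

theorem mem_comp_pinv_right (h : IsRegularPair A t s)
    (ht : IsOrthogonallyComplemented A (range t).topologicalClosure) {y q : Y} :
    (y, q) ∈ (comp t (pinv t s)).graph ↔
      y ∈ (pinv t s).domain ∧ (y, q) ∈ (projectionOp ht).graph := by
  have hle : ∀ {y q}, (y, q) ∈ (comp t (pinv t s)).graph → (y, q) ∈ (projectionOp ht).graph := by
    intro y q hyq
    obtain ⟨x, hx, hq⟩ := mem_comp_graph.1 hyq
    rw [mem_projectionOp_graph, h.mem_orthogonal_closure_range]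
    obtain ⟨-, z, hz, hxz⟩ := h.mem_pinv_graph.1 hx
    have := t.mem_graph_snd_inj hq hxz rfl
    refine ⟨(range t).le_topologicalClosure (mem_range_iff.2 ⟨x, hq⟩), ?_⟩
    rwa [this, sub_sub_cancel]
  refine ⟨fun hyq => ⟨?_, hle hyq⟩, ?_⟩
  · obtain ⟨x, hx, -⟩ := mem_comp_graph.1 hyq
    exact LinearPMap.mem_domain_of_mem_graph hx
  · rintro ⟨hy, hq⟩
    obtain ⟨x, hx⟩ := LinearPMap.mem_domain_iff.1 hy
    obtain ⟨-, z, hz, hxz⟩ := h.mem_pinv_graph.1 hx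
    have hy' : (y, y - z) ∈ (comp t (pinv t s)).graph := mem_comp_graph.2 ⟨x, hx, hxz⟩
    rwa [(projectionOp ht).mem_graph_snd_inj hq (hle hy') rfl]

theorem comp_pinv_left_dense (h : IsRegularPair A t s)
    (hs : IsOrthogonallyComplemented A (range s).topologicalClosure) :
    IsDenselyDefined (comp (pinv t s) t) := by
  refine h.dense_left.mono fun x hx => ?_
  exact LinearPMap.mem_domain_of_mem_graph ((h.mem_comp_pinv_left hs).2
    ⟨hx, (projectionOp hs).mem_graph ⟨x, trivial⟩⟩)

theorem comp_pinv_right_dense (h : IsRegularPair A t s)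
    (hs : IsOrthogonallyComplemented A (range s).topologicalClosure)
    (ht : IsOrthogonallyComplemented A (range t).topologicalClosure) :
    IsDenselyDefined (comp t (pinv t s)) := by
  refine (h.isDenselyDefined_pinv hs ht).mono fun y hy => ?_
  exact LinearPMap.mem_domain_of_mem_graph ((h.mem_comp_pinv_right ht).2
    ⟨hy, (projectionOp ht).mem_graph ⟨y, trivial⟩⟩)

theorem comp_pinv_left_le (h : IsRegularPair A t s)
    (hs : IsOrthogonallyComplemented A (range s).topologicalClosure) :
    comp (pinv t s) t ≤ projectionOp hs :=
  LinearPMap.le_of_le_graph fun _ hp => ((h.mem_comp_pinv_left hs).1 hp).2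

theorem comp_pinv_right_le (h : IsRegularPair A t s)
    (ht : IsOrthogonallyComplemented A (range t).topologicalClosure) :
    comp t (pinv t s) ≤ projectionOp ht :=
  LinearPMap.le_of_le_graph fun _ hp => ((h.mem_comp_pinv_right ht).1 hp).2

theorem isMoorePenroseInverse_pinv (h : IsRegularPair A t s)
    (hs : IsOrthogonallyComplemented A (range s).topologicalClosure)
    (ht : IsOrthogonallyComplemented A (range t).topologicalClosure) :
    IsMoorePenroseInverse A t (pinv t s) where
  regular := (h.pinv_isRegularPair hs ht).isRegular
  mul_mul_left := by
    apply ext_graph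
    intro x y
    rw [mem_comp_graph]
    constructor
    · rintro ⟨p, hp, hpy⟩
      have := ((h.mem_comp_pinv_left hs).1 hp).2
      rw [mem_projectionOp_graph, h.symm.mem_orthogonal_closure_range] at this
      simpa using t.graph.add_mem hpy this.2
    · intro hx
      obtain ⟨p, hp, k, hk, rfl⟩ := h.exists_add_ker hs x
      exact ⟨p, mem_comp_graph.2 ⟨y, hx, h.mem_pinv_of_add hp hk hx⟩,
        by simpa using t.graph.sub_mem hx hk⟩
  mul_mul_right := by
    apply ext_graph
    intro y x
    rw [mem_comp_graph]
    constructor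
    · rintro ⟨q, hq, hqx⟩
      have h1 := ((h.mem_comp_pinv_right ht).1 hq).2
      rw [mem_projectionOp_graph, h.mem_orthogonal_closure_range] at h1
      rw [h.mem_pinv_graph] at hqx ⊢
      obtain ⟨hx, z, hz, hxz⟩ := hqx
      refine ⟨hx, y - q + z, by simpa using s.graph.add_mem h1.2 hz, ?_⟩
      have e : y - (y - q + z) = q - z := by abel
      rwa [e]
    · intro hx
      obtain ⟨hx', z, hz, hxz⟩ := h.mem_pinv_graph.1 hx
      refine ⟨y - z, mem_comp_graph.2 ⟨x, hx, hxz⟩, ?_⟩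
      exact h.mem_pinv_graph.2 ⟨hx', 0, s.graph.zero_mem, by simpa using hxz⟩
  adjoint_left := by
    rw [adjoint_eq_projectionOp ht (h.comp_pinv_right_dense hs ht) (h.comp_pinv_right_le ht),
      closure_eq_projectionOp ht (h.comp_pinv_right_dense hs ht) (h.comp_pinv_right_le ht)]
  adjoint_right := by
    rw [adjoint_eq_projectionOp hs (h.comp_pinv_left_dense hs) (h.comp_pinv_left_le hs),
      closure_eq_projectionOp hs (h.comp_pinv_left_dense hs) (h.comp_pinv_left_le hs)]

end IsRegularPair

/-- A densely defined operator whose adjoint is its closure is symmetric. -/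
theorem isFormalAdjoint_self {f : X →ₗ.[ℂ] X} (hd : IsDenselyDefined f)
    (hf : adjoint A f = f.closure) : IsFormalAdjoint A f f := by
  intro x x' y y' hx hy
  exact isFormalAdjoint_adjoint (A := A) hd x x' y y' hx
    (hf ▸ LinearPMap.le_graph_of_le f.le_closure hy)

/-- The Moore-Penrose inverse is unique. -/
theorem IsMoorePenroseInverse.eq_pinv {t : X →ₗ.[ℂ] Y} {s r : Y →ₗ.[ℂ] X}
    (hr : IsMoorePenroseInverse A t r) (h : IsRegularPair A t s)
    (hs : IsOrthogonallyComplemented A (range s).topologicalClosure)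
    (ht : IsOrthogonallyComplemented A (range t).topologicalClosure) : r = pinv t s := by
  -- Equality of domains in trt = t puts Ran t inside Dom r, where tr acts as the identity; `hr1` is
  -- the mirror statement for rtr = r.
  have ht1 : ∀ {x y}, (x, y) ∈ t.graph → ∃ u, (y, u) ∈ r.graph ∧ (u, y) ∈ t.graph := by
    intro x y hx
    obtain ⟨u, hu, huy⟩ := mem_comp_graph.1 (hr.mul_mul_left.symm ▸ hx)
    obtain ⟨y', hy', hu⟩ := mem_comp_graph.1 hu
    rw [t.mem_graph_snd_inj hy' hx rfl] at hu
    exact ⟨u, hu, huy⟩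
  have hr1 : ∀ {y x}, (y, x) ∈ r.graph → ∃ v, (x, v) ∈ t.graph ∧ (v, x) ∈ r.graph := by
    intro y x hy
    obtain ⟨v, hv, hvx⟩ := mem_comp_graph.1 (hr.mul_mul_right.symm ▸ hy)
    obtain ⟨x', hx', hv⟩ := mem_comp_graph.1 hv
    rw [r.mem_graph_snd_inj hx' hy rfl] at hv
    exact ⟨v, hv, hvx⟩
  have hd1 : IsDenselyDefined (comp t r) := by
    refine hr.regular.denselyDefined.mono fun y hy => ?_
    obtain ⟨v, hv, -⟩ := hr1 (r.mem_graph ⟨y, hy⟩)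
    exact LinearPMap.mem_domain_of_mem_graph (mem_comp_graph.2 ⟨_, r.mem_graph ⟨y, hy⟩, hv⟩)
  have hd2 : IsDenselyDefined (comp r t) := by
    refine h.dense_left.mono fun x hx => ?_
    obtain ⟨u, hu, -⟩ := ht1 (t.mem_graph ⟨x, hx⟩)
    exact LinearPMap.mem_domain_of_mem_graph (mem_comp_graph.2 ⟨_, t.mem_graph ⟨x, hx⟩, hu⟩)
  have hs1 := isFormalAdjoint_self hd1 hr.adjoint_left
  have hs2 := isFormalAdjoint_self hd2 hr.adjoint_right
  have hker : ∀ {y x v}, (y, x) ∈ r.graph → (x, v) ∈ t.graph → (y - v, 0) ∈ s.graph := by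
    intro y x v hy hx
    rw [← h.mem_orthogonal_range]
    intro w hw
    obtain ⟨a, ha⟩ := mem_range_iff.1 hw
    obtain ⟨u, hu, huw⟩ := ht1 ha
    -- As tr is symmetric and fixes `w`, ⟪w, y⟫ = ⟪w, try⟫.
    have := hs1 w w y v (mem_comp_graph.2 ⟨u, hu, huw⟩) (mem_comp_graph.2 ⟨x, hy, hx⟩)
    rw [CStarModule.inner_sub_right, this, sub_self]
  have hle : r.graph ≤ (pinv t s).graph := by
    rintro ⟨y, x⟩ hy
    obtain ⟨v, hv, hvx⟩ := hr1 hy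
    refine h.mem_pinv_graph.2 ⟨?_, y - v, hker hy hv, by simpa using hv⟩
    refine h.mem_closure_range hs fun k hk => ?_
    -- As rt is symmetric, kills `k` and fixes `x`, ⟪k, x⟫ = 0.
    have := hs2 k 0 x x (mem_comp_graph.2 ⟨0, hk, r.graph.zero_mem⟩)
      (mem_comp_graph.2 ⟨v, hv, hvx⟩)
    rw [← this, CStarModule.inner_zero_left]
  have hker' : ∀ {z}, (z, 0) ∈ s.graph → (z, 0) ∈ r.graph := by
    intro z hz
    set P := (range t).topologicalClosure.projection _ ht
    have hPz : P z = 0 := (Submodule.projection_apply_eq_zero_iff ht).2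
      (h.mem_orthogonal_closure_range.2 hz)
    -- On Dom r one has Py = try and r(try) = ry, so r kills y - Py. Density of Dom r and closedness
    -- of r extend this to all y, in particular to z, where Pz = 0.
    have hcont : Continuous fun y : Y => (y - P y, (0 : X)) :=
      (continuous_id.sub (continuous_projection ht)).prodMk continuous_const
    have hmap : Set.MapsTo (fun y : Y => (y - P y, (0 : X))) (r.domain : Set Y)
        (r.graph : Set (Y × X)) := by
      intro y hy
      have hy := r.mem_graph ⟨y, hy⟩
      obtain ⟨v, hv, hvx⟩ := hr1 hy
      have hPy : P y = v := by
        have e : P (y - v) = 0 := (Submodule.projection_apply_eq_zero_iff ht).2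
          (h.mem_orthogonal_closure_range.2 (hker hy hv))
        rw [map_sub, Submodule.projection_apply_of_mem_left ht
          ((range t).le_topologicalClosure (mem_range_iff.2 ⟨_, hv⟩)), sub_eq_zero] at e
        exact e
      have := r.graph.sub_mem hy hvx
      rw [Prod.mk_sub_mk, sub_self] at this
      simpa only [SetLike.mem_coe, hPy] using this
    have hmem := map_mem_closure hcont (hr.regular.denselyDefined z) hmap
    rw [hr.regular.isClosed.closure_eq, hPz, sub_zero] at hmem
    exact hmem
  refine LinearPMap.eq_of_eq_graph (le_antisymm hle ?_)
  rintro ⟨y, x⟩ hy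
  obtain ⟨hx, z, hz, hxz⟩ := h.mem_pinv_graph.1 hy
  -- Ran t and ker s both lie in Dom r, so Dom t† does too; with r ⊆ t† the values then agree.
  obtain ⟨u, hu, -⟩ := ht1 hxz
  have hyu := r.graph.add_mem hu (hker' hz)
  rw [Prod.mk_add_mk, sub_add_cancel, add_zero] at hyu
  rwa [(pinv t s).mem_graph_snd_inj hy (hle hyu) rfl]

end PseudoInverse

end HilbertModuleOp

/-! ### The proposition and the self-adjointness criterion. -/

theorem proposition2p7 {A X : Type*} [NonUnitalCStarAlgebra A] [PartialOrder A]
    [StarOrderedRing A] [NormedAddCommGroup X] [NormedSpace ℂ X] [SMul A X] [CStarModule A X]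
    [CompleteSpace X] (t : X →ₗ.[ℂ] X) (ht : HilbertModuleOp.IsRegular A t)
    (hadj : HilbertModuleOp.IsOrthogonallyComplemented A
      (HilbertModuleOp.range (HilbertModuleOp.adjoint A t)).topologicalClosure)
    (hran : HilbertModuleOp.IsOrthogonallyComplemented A
      (HilbertModuleOp.range t).topologicalClosure) :
    ∃ tdag : X →ₗ.[ℂ] X,
      HilbertModuleOp.IsMoorePenroseInverse A t tdag ∧
      (∀ s : X →ₗ.[ℂ] X, HilbertModuleOp.IsMoorePenroseInverse A t s → s = tdag) ∧
      (HilbertModuleOp.IsSelfAdjointOp A t ↔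
        t = HilbertModuleOp.comp (HilbertModuleOp.comp tdag t).closure
          (HilbertModuleOp.adjoint A t)) := by
  have h := ht.isRegularPair
  refine ⟨HilbertModuleOp.pinv t (HilbertModuleOp.adjoint A t),
    h.isMoorePenroseInverse_pinv hadj hran, fun s hs => hs.eq_pinv h hadj hran, ?_⟩
  -- The closure of t†t is the everywhere defined projection onto closure(Ran t*), so composing it
  -- with t* changes neither values nor domain.
  have key : HilbertModuleOp.comp (HilbertModuleOp.comp
      (HilbertModuleOp.pinv t (HilbertModuleOp.adjoint A t)) t).closure
      (HilbertModuleOp.adjoint A t) = HilbertModuleOp.adjoint A t := by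
    rw [HilbertModuleOp.closure_eq_projectionOp hadj (h.comp_pinv_left_dense hadj)
      (h.comp_pinv_left_le hadj)]
    have hP : ∀ {y x}, (y, x) ∈ (HilbertModuleOp.adjoint A t).graph →
        (x, x) ∈ (HilbertModuleOp.projectionOp hadj).graph := by
      intro y x hyx
      rw [HilbertModuleOp.mem_projectionOp_graph, sub_self]
      exact ⟨Submodule.le_topologicalClosure _ (HilbertModuleOp.mem_range_iff.2 ⟨y, hyx⟩),
        zero_mem _⟩
    apply HilbertModuleOp.ext_graph
    intro y z
    rw [HilbertModuleOp.mem_comp_graph]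
    constructor
    · rintro ⟨x, hyx, hxz⟩
      rwa [(HilbertModuleOp.projectionOp hadj).mem_graph_snd_inj hxz (hP hyx) rfl]
    · exact fun hyz => ⟨z, hyz, hP hyz⟩
  rw [key]
  exact ⟨fun hsa => hsa.2.symm, fun he => ⟨ht.denselyDefined, he.symm⟩⟩
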